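/- For an integer $n>1$, let $T_n$ be the number of ways to seat $n$ married female--male couples ($2n$ distinguishable people) on the $2n$ labelled seats of a circular table so that no two spouses sit next to each other and no three consecutive people are of the same sex. Then $T_n$ is given by each of the following three formulas, in which $[\cdot]$ denotes coefficient extraction and both integrals converge absolutely. (1) $$T_n = n!\sum_{j=0}^n (-1)^j\,(n-j)!\,[y^0z^j]\ \operatorname{tr}(B^{2n}),\qquad B= \begin{bmatrix} 0 & y^{-1} & 0 & y & 0 & 0\\ yz & 0 & y^{-1} & 0 & y & 0\\ yz & 0 & 0 & 0 & y & 0 \\ 0 & y^{-1} & 0 & 0 & 0 & y^{-1}z\\ 0 & y^{-1} & 0 & y & 0 & y^{-1}z\\ 0 & 0 & y^{-1} & 0 & y & 0 \end{bmatrix},$$ where the entries of $B$ lie in $\mathbb{Z}[z][y,y^{-1}]$. (2) $$T_n = n!\int_0^{\infty} [y^n]\ \operatorname{tr}(B_2^{n})\; e^{-t}\,dt,\qquad B_2 = \begin{bmatrix} -y& yt& t& 0& yt& -y \\ -y& y(t - 1)& 0& y^2(t - 1)& yt& -y \\ 0& y(t - 1)& 0& y^2(t - 1)& 0& -y \\ -y&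 0& t - 1& 0& y(t - 1)& 0 \\ -y& yt& t - 1& 0& y(t - 1)& -y \\ -y& yt& 0& y^2t& yt& -y \end{bmatrix}.$$ (3) $$T_n = n!\int_0^{\infty} [x^ny^n]\ \frac{a(xy,t) + b(xy,t)\,(x+xy^2)}{c(xy,t)+d(xy,t)\,(x+xy^2)}\; e^{-t}\,dt,$$ where, for each real $t$, the rational function is expanded as a power series in $x$ and $y$ (its denominator has constant term $1$), and $$\begin{aligned} a(p,t) ={}& -2p^5t^3+2p^4t^4+4p^5t^2-8p^4t^3-2p^5t+12p^4t^2-8p^4t+6p^3t-4p^2t^2\\ &+16p^2-10pt+20p+6,\\ b(p,t) ={}& -p^2t(2+p-t)(p-3t+6),\\ c(p,t) ={}& p^6t^2-2p^5t^3+p^4t^4+4p^5t^2-4p^4t^3-2p^5t+6p^4t^2-4p^4t+2p^3t-p^2t^2\\ &+4p^2-2pt+4p+1,\\ d(p,t) ={}& -p^2t(2+p-t)^2. \end{aligned}$$ -/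

import Mathlib

namespace TernaryMenage

/-- A person is a pair `(i, s)`: the couple `i` the person belongs to, and the sex `s`
(`false` for female, `true` for male). -/
abbrev Person (n : ℕ) : Type := Fin n × Bool

/-- A seating of the `2n` people on the `2n` labelled seats of a circular table; the seat clockwise
after seat `i` is `finRotate (2 * n) i`. -/
abbrev Seating (n : ℕ) : Type := Fin (2 * n) ≃ Person n

/-- No spouses sit next to each other. -/
def NoCloseCouple {n : ℕ} (s : Seating n) : Prop :=
  ∀ i : Fin (2 * n), (s i).1 ≠ (s (finRotate (2 * n) i)).1

/-- No three consecutive people are of the same sex. -/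
def NoThreeSameSex {n : ℕ} (s : Seating n) : Prop :=
  ∀ i : Fin (2 * n),
    ¬ ((s i).2 = (s (finRotate (2 * n) i)).2 ∧
       (s (finRotate (2 * n) i)).2 = (s (finRotate (2 * n) (finRotate (2 * n) i))).2)

/-- The number of seating arrangements of `n` couples in the ternary menage problem. -/
noncomputable def count (n : ℕ) : ℕ :=
  Nat.card {s : Seating n // NoCloseCouple s ∧ NoThreeSameSex s}

open LaurentPolynomial in
/-- The weighted adjacency matrix `B`, with entries in `ℤ[z][y, y⁻¹]`. Rows and columns are indexed
by the nodes `fm⋆, mf, ff, mm, fm, mf⋆` of the graph, in this order. An arc from `uv` to `vw` has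
weight `y` if `w = m` and `y⁻¹` if `w = f`, times `z` if the node `vw` is starred. -/
noncomputable def matB :
    Matrix (Fin 6) (Fin 6) (LaurentPolynomial (Polynomial ℤ)) :=
  let y : LaurentPolynomial (Polynomial ℤ) := T 1
  let y' : LaurentPolynomial (Polynomial ℤ) := T (-1)
  let z : LaurentPolynomial (Polynomial ℤ) := C Polynomial.X
  !![0,     y', 0,  y, 0, 0;
     y * z, 0,  y', 0, y, 0;
     y * z, 0,  0,  0, y, 0;
     0,     y', 0,  0, 0, y' * z;
     0,     y', 0,  y, 0, y' * z;
     0,     0,  y', 0, y, 0]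

/-- The matrix `B₂` at the real number `t`, with entries in `ℝ[y]`. -/
noncomputable def matB2 (r : ℝ) : Matrix (Fin 6) (Fin 6) (Polynomial ℝ) :=
  let y : Polynomial ℝ := Polynomial.X
  let t : Polynomial ℝ := Polynomial.C r
  !![-y, y * t,       t,     0,             y * t,       -y;
     -y, y * (t - 1), 0,     y ^ 2 * (t - 1), y * t,       -y;
     0,  y * (t - 1), 0,     y ^ 2 * (t - 1), 0,           -y;
     -y, 0,           t - 1, 0,             y * (t - 1), 0;
     -y, y * t,       t - 1, 0,             y * (t - 1), -y;
     -y, y * t,       0,     y ^ 2 * t,       y * t,       -y]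

section Polynomials

variable {R : Type*} [CommRing R]

/-- The polynomial `a(p,t)`. -/
def polyA (p t : R) : R :=
  -2 * p ^ 5 * t ^ 3 + 2 * p ^ 4 * t ^ 4 + 4 * p ^ 5 * t ^ 2 - 8 * p ^ 4 * t ^ 3 - 2 * p ^ 5 * t
    + 12 * p ^ 4 * t ^ 2 - 8 * p ^ 4 * t + 6 * p ^ 3 * t - 4 * p ^ 2 * t ^ 2
    + 16 * p ^ 2 - 10 * p * t + 20 * p + 6

/-- The polynomial `b(p,t)`. -/
def polyB (p t : R) : R :=
  -p ^ 2 * t * (2 + p - t) * (p - 3 * t + 6)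

/-- The polynomial `c(p,t)`. -/
def polyC (p t : R) : R :=
  p ^ 6 * t ^ 2 - 2 * p ^ 5 * t ^ 3 + p ^ 4 * t ^ 4 + 4 * p ^ 5 * t ^ 2 - 4 * p ^ 4 * t ^ 3
    - 2 * p ^ 5 * t + 6 * p ^ 4 * t ^ 2 - 4 * p ^ 4 * t + 2 * p ^ 3 * t - p ^ 2 * t ^ 2
    + 4 * p ^ 2 - 2 * p * t + 4 * p + 1

/-- The polynomial `d(p,t)`. -/
def polyD (p t : R) : R :=
  -p ^ 2 * t * (2 + p - t) ^ 2

end Polynomials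

/-- The numerator `a(xy,t) + b(xy,t)(x + xy²)`, as a power series in `x` and `y` over `ℝ`. -/
noncomputable def ratNum (r : ℝ) : MvPowerSeries (Fin 2) ℝ :=
  let x : MvPowerSeries (Fin 2) ℝ := MvPowerSeries.X 0
  let y : MvPowerSeries (Fin 2) ℝ := MvPowerSeries.X 1
  let t : MvPowerSeries (Fin 2) ℝ := MvPowerSeries.C r
  polyA (x * y) t + polyB (x * y) t * (x + x * y ^ 2)

/-- The denominator `c(xy,t) + d(xy,t)(x + xy²)`, as a power series in `x` and `y` over `ℝ`. -/
noncomputable def ratDen (r : ℝ) : MvPowerSeries (Fin 2) ℝ :=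
  let x : MvPowerSeries (Fin 2) ℝ := MvPowerSeries.X 0
  let y : MvPowerSeries (Fin 2) ℝ := MvPowerSeries.X 1
  let t : MvPowerSeries (Fin 2) ℝ := MvPowerSeries.C r
  polyC (x * y) t + polyD (x * y) t * (x + x * y ^ 2)

/-- The denominator has constant term `1`, so that its inverse below is a genuine one. -/
theorem constantCoeff_ratDen (r : ℝ) : MvPowerSeries.constantCoeff (ratDen r) = 1 := by
  simp [ratDen, polyC, polyD]

/-- The power series expansion in `x` and `y` of the rational function
`(a(xy,t) + b(xy,t)(x + xy²)) / (c(xy,t) + d(xy,t)(x + xy²))`. -/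
noncomputable def ratSeries (r : ℝ) : MvPowerSeries (Fin 2) ℝ :=
  ratNum r * (ratDen r)⁻¹

/-- The series is the quotient: multiplied by the denominator it gives the numerator. -/
theorem ratSeries_mul_ratDen (r : ℝ) : ratSeries r * ratDen r = ratNum r := by
  rw [ratSeries, mul_assoc, MvPowerSeries.inv_mul_cancel _ (by simp [constantCoeff_ratDen]),
    mul_one]

end TernaryMenage

/-!
**The formula with `B`.** By inclusion–exclusion over the couples that sit together, the count is
the sum of `(-1)^|A|` over the seatings without three consecutive people of the same sex and the
sets `A` of seats `i` such that `i` and `i + 1` are taken by a couple (`count_eq_sum_patterns`).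
Forgetting the names of the couples turns a pair (seating, `A`) into a marked pattern
(`IsMarkedPattern`): a cyclic balanced word in the letters `f`, `m` with disjoint mixed marked
pairs. Conversely each marked pattern comes from exactly `n! (n - |A|)!` seatings
(`card_patternSeating`): two of them differ by a permutation of the women and a permutation of the
men that agree on the marked couples. Finally the marked patterns with `|A| = j` are the closed
walks of length `2n` in the graph with weighted adjacency matrix `B` whose weight is `y⁰zʲ`, so
that their number is `[y⁰zʲ] tr (B²ⁿ)` (`coeff_trace_matB_eq_card_patterns`).

**The formula with `B₂`.** Write `(n - j)! = ∫ tⁿ⁻ʲ e⁻ᵗ dt`. As `[y⁰] tr (B²ⁿ)` has degree at most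
`n` in `z` (there are only `n` couples to mark), the sum under the integral is `tⁿ` times its
value at `z = -1/t`, and for this `z` one has `B₂(y²) = y² t B(y)²` (`genB2_sq_eq`), which gives
`coeff_trace_matB2`.

**The rational function.** The determinant of `1 - x B₂` is the denominator and the trace of its
adjugate is the numerator of the rational function, which is thus `tr (1 - x B₂)⁻¹ = ∑ₖ xᵏ tr
(B₂ᵏ)`; hence the two integrands coincide (`coeff_ratSeries`).
-/

namespace TernaryMenage

/-! ### The rational generating function -/

section Rational

variable {R : Type*} [CommRing R]

/-- The matrix `B₂` with `y` and `t` in an arbitrary commutative ring. -/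
def genB2 (y t : R) : Matrix (Fin 6) (Fin 6) R :=
  !![-y, y * t,       t,     0,             y * t,       -y;
     -y, y * (t - 1), 0,     y ^ 2 * (t - 1), y * t,       -y;
     0,  y * (t - 1), 0,     y ^ 2 * (t - 1), 0,           -y;
     -y, 0,           t - 1, 0,             y * (t - 1), 0;
     -y, y * t,       t - 1, 0,             y * (t - 1), -y;
     -y, y * t,       0,     y ^ 2 * t,       y * t,       -y]

theorem genB2_map {S : Type*} [CommRing S] (f : R →+* S) (y t : R) :
    (genB2 y t).map f = genB2 (f y) (f t) := by
  ext i j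
  fin_cases i <;> fin_cases j <;> simp [genB2]

theorem one_sub_smul_genB2 (x y t : R) : 1 - x • genB2 y t =
    !![1 + x * y, -x * (y * t), -x * t, 0, -x * (y * t), x * y;
      x * y, 1 - x * (y * (t - 1)), 0, -x * (y ^ 2 * (t - 1)), -x * (y * t), x * y;
      0, -x * (y * (t - 1)), 1, -x * (y ^ 2 * (t - 1)), 0, x * y;
      x * y, 0, -x * (t - 1), 1, -x * (y * (t - 1)), 0;
      x * y, -x * (y * t), -x * (t - 1), 0, 1 - x * (y * (t - 1)), x * y;
      x * y, -x * (y * t), 0, -x * (y ^ 2 * t), -x * (y * t), 1 + x * y] := by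
  ext i j
  fin_cases i <;> fin_cases j <;> simp [genB2]

set_option maxHeartbeats 4000000 in
theorem det_one_sub_smul_genB2 (x y t : R) :
    (1 - x • genB2 y t).det = polyC (x * y) t + polyD (x * y) t * (x + x * y ^ 2) := by
  rw [one_sub_smul_genB2]
  simp [Matrix.det_succ_row_zero, Fin.sum_univ_succ, Fin.succAbove]
  simp only [polyC, polyD]
  ring

set_option maxHeartbeats 4000000 in
theorem trace_adjugate_one_sub_smul_genB2 (x y t : R) :
    (1 - x • genB2 y t).adjugate.trace =
      polyA (x * y) t + polyB (x * y) t * (x + x * y ^ 2) := by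
  rw [one_sub_smul_genB2, Matrix.trace]
  simp [Matrix.adjugate_fin_succ_eq_det_submatrix, Matrix.det_succ_row_zero, Fin.sum_univ_succ,
    Fin.succAbove]
  simp only [polyA, polyB]
  ring

end Rational

theorem map_trace_pow {ι R S : Type*} [Fintype ι] [DecidableEq ι] [CommRing R] [CommRing S]
    (f : R →+* S) (M : Matrix ι ι R) (n : ℕ) :
    f (M ^ n).trace = (M.map f ^ n).trace := by
  rw [← RingHom.mapMatrix_apply, ← map_pow, RingHom.mapMatrix_apply]
  simp [Matrix.trace, map_sum]

/-- Extracting `[xⁿyⁿ]` from `xᵏ p(y)`. -/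
theorem coeff_X_pow_mul_eval₂ (n k : ℕ) (p : Polynomial ℝ) :
    MvPowerSeries.coeff (Finsupp.single 0 n + Finsupp.single 1 n)
      ((MvPowerSeries.X 0 : MvPowerSeries (Fin 2) ℝ) ^ k *
        Polynomial.eval₂RingHom MvPowerSeries.C (MvPowerSeries.X 1) p) =
      if k = n then p.coeff n else 0 := by
  induction p using Polynomial.induction_on' with
  | add p q hp hq =>
    rw [map_add, mul_add, map_add, hp, hq]
    split_ifs <;> simp
  | monomial m a =>
    have h : (Finsupp.single 0 n + Finsupp.single 1 n : Fin 2 →₀ ℕ) =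
        Finsupp.single 0 k + Finsupp.single 1 m ↔ k = n ∧ m = n := by
      constructor
      · intro h
        exact ⟨by simpa using (DFunLike.congr_fun h 0).symm,
          by simpa using (DFunLike.congr_fun h 1).symm⟩
      · rintro ⟨rfl, rfl⟩; rfl
    simp only [Polynomial.coe_eval₂RingHom, Polynomial.eval₂_monomial]
    rw [mul_left_comm, MvPowerSeries.coeff_C_mul, MvPowerSeries.X_pow_eq, MvPowerSeries.X_pow_eq,
      MvPowerSeries.monomial_mul_monomial, MvPowerSeries.coeff_monomial, Polynomial.coeff_monomial]
    simp only [h]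
    by_cases hk : k = n <;> by_cases hm : m = n <;> simp [hk, hm]

/-- Since `tr (1 - xB₂)⁻¹ = ∑ₖ xᵏ tr (B₂ᵏ)`, the rational function is the generating
function of the traces `tr (B₂ᵏ)`; only the term `k = n` contributes to `[xⁿyⁿ]`. -/
theorem coeff_ratSeries (n : ℕ) (r : ℝ) :
    MvPowerSeries.coeff (Finsupp.single 0 n + Finsupp.single 1 n) (ratSeries r) =
      (Matrix.trace (matB2 r ^ n)).coeff n := by
  set χ : Polynomial ℝ →+* MvPowerSeries (Fin 2) ℝ :=
    Polynomial.eval₂RingHom MvPowerSeries.C (MvPowerSeries.X 1) with hχ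
  set x : MvPowerSeries (Fin 2) ℝ := MvPowerSeries.X 0 with hx
  set M := (matB2 r).map χ with hM
  have hM' : M = genB2 (MvPowerSeries.X 1) (MvPowerSeries.C r) := by
    have : matB2 r = genB2 Polynomial.X (Polynomial.C r) := rfl
    rw [hM, this, genB2_map]
    simp [hχ]
  have hdet : (1 - x • M).det = ratDen r := by
    rw [hM', det_one_sub_smul_genB2]; rfl
  have hadj : (1 - x • M).adjugate.trace = ratNum r := by
    rw [hM', trace_adjugate_one_sub_smul_genB2]; rfl
  set S := (ratDen r)⁻¹ • (1 - x • M).adjugate with hS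
  have hS1 : (1 - x • M) * S = 1 := by
    rw [hS, Matrix.mul_smul, Matrix.mul_adjugate, hdet, smul_smul,
      MvPowerSeries.inv_mul_cancel _ (by simp [constantCoeff_ratDen]), one_smul]
  have htr : ratSeries r = S.trace := by
    rw [hS, Matrix.trace_smul, hadj, ratSeries, smul_eq_mul, mul_comm]
  -- A geometric series cut off at `xⁿ`; the remainder is divisible by `xⁿ⁺¹`.
  have hgeom : S = ∑ k ∈ Finset.range (n + 1), (x • M) ^ k + (x • M) ^ (n + 1) * S := by
    have h := geom_sum_mul_neg (x • M) (n + 1)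
    have h2 := congrArg (· * S) h
    simp only [mul_assoc, hS1, mul_one, sub_mul, one_mul] at h2
    rw [h2]; abel
  have hcoef : ∀ k, ((x • M) ^ k).trace = x ^ k * χ (Matrix.trace (matB2 r ^ k)) := by
    intro k
    rw [smul_pow, Matrix.trace_smul, smul_eq_mul, hM]
    rw [map_trace_pow]
  have hzero : MvPowerSeries.coeff (Finsupp.single 0 n + Finsupp.single 1 n)
      ((x • M) ^ (n + 1) * S).trace = 0 := by
    rw [smul_pow, Matrix.smul_mul, Matrix.trace_smul, smul_eq_mul]
    exact MvPowerSeries.X_pow_dvd_iff.1 (Dvd.intro _ rfl) _ (by simp)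
  rw [htr, hgeom, Matrix.trace_add, map_add, hzero, add_zero, Matrix.trace_sum, map_sum]
  simp only [hcoef]
  rw [Finset.sum_congr rfl fun k _ => coeff_X_pow_mul_eval₂ n k _]
  simp

/-! ### From the trace of `B` to the trace of `B₂` -/

/-- The matrix `B` with `y`, `y⁻¹` and `z` in an arbitrary commutative ring; `y'` stands for
`y⁻¹`. -/
def genB {R : Type*} [CommRing R] (y y' z : R) : Matrix (Fin 6) (Fin 6) R :=
  !![0,     y', 0,  y, 0, 0;
     y * z, 0,  y', 0, y, 0;
     y * z, 0,  0,  0, y, 0;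
     0,     y', 0,  0, 0, y' * z;
     0,     y', 0,  y, 0, y' * z;
     0,     0,  y', 0, y, 0]

theorem genB_map {R S : Type*} [CommRing R] [CommRing S] (f : R →+* S) (y y' z : R) :
    (genB y y' z).map f = genB (f y) (f y') (f z) := by
  ext i j
  fin_cases i <;> fin_cases j <;> simp [genB]

/-- Up to the substitutions `y ↦ y²` and `z = -1/t` and a scalar, `B₂` is the square of `B`. -/
theorem genB2_sq_eq {R : Type*} [CommRing R] {y y' z t : R} (hy : y * y' = 1) (hz : t * z = -1) :
    genB2 (y ^ 2) t = (y ^ 2 * t) • genB y y' z ^ 2 := by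
  ext i j
  rw [sq (genB y y' z)]
  fin_cases i <;> fin_cases j <;>
    simp [genB, genB2] <;> grind

open LaurentPolynomial in
/-- Extracting a coefficient of `p(y²)`, which is the form in which `B₂` is compared with `B²`. -/
theorem coeff_eval₂_T_two (p : Polynomial ℝ) (n : ℕ) :
    (Polynomial.eval₂RingHom (C : ℝ →+* LaurentPolynomial ℝ) (T 2) p).coeff (2 * n : ℤ) =
      p.coeff n := by
  induction p using Polynomial.induction_on' with
  | add p q hp hq =>
    rw [map_add, AddMonoidAlgebra.coeff_add, Finsupp.add_apply, hp, hq, Polynomial.coeff_add]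
  | monomial m a =>
    rw [Polynomial.coe_eval₂RingHom, Polynomial.eval₂_monomial, T_pow, ← single_eq_C_mul_T,
      Polynomial.coeff_monomial, AddMonoidAlgebra.coeff_single, Finsupp.single_apply]
    exact if_congr (by omega) rfl rfl

open LaurentPolynomial in
/-- From `B₂(y²) = y² t B(y)²` at `z = -1/t`: the coefficient `[yⁿ] tr (B₂ⁿ)` is `[y²ⁿ]` of
`y²ⁿ tⁿ tr (B²ⁿ)`. -/
theorem coeff_trace_matB2 (n : ℕ) {t : ℝ} (ht : t ≠ 0) :
    (Matrix.trace (matB2 t ^ n)).coeff n =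
      t ^ n * Polynomial.eval₂ (Int.castRingHom ℝ) (-1 / t)
        ((Matrix.trace (matB ^ (2 * n))).coeff 0) := by
  set φ : LaurentPolynomial (Polynomial ℤ) →+* LaurentPolynomial ℝ :=
    AddMonoidAlgebra.mapRingHom ℤ (Polynomial.eval₂RingHom (Int.castRingHom ℝ) (-1 / t)) with hφ
  set ψ : Polynomial ℝ →+* LaurentPolynomial ℝ := Polynomial.eval₂RingHom C (T 2) with hψ
  have hB : matB.map φ = genB (T 1) (T (-1)) (C (-1 / t)) := by
    have : matB = genB (T 1) (T (-1)) (C (Polynomial.X : Polynomial ℤ)) := rfl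
    rw [this, genB_map]
    congr 1
    · exact (AddMonoidAlgebra.mapRingHom_single _ _ _).trans (by rw [map_one]; rfl)
    · exact (AddMonoidAlgebra.mapRingHom_single _ _ _).trans (by rw [map_one]; rfl)
    · rw [← single_eq_C, ← single_eq_C, hφ, AddMonoidAlgebra.mapRingHom_single]
      simp
  have hB2 : (matB2 t).map ψ = (T 2 * C t) • (matB.map φ) ^ 2 := by
    have h1 : matB2 t = genB2 Polynomial.X (Polynomial.C t) := rfl
    have h2 : ψ Polynomial.X = T 1 ^ 2 := by simp [hψ]
    have h3 : ψ (Polynomial.C t) = C t := by simp [hψ]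
    rw [h1, genB2_map, h2, h3, hB, genB2_sq_eq (y' := T (-1)) (z := C (-1 / t))]
    · simp
    · rw [← T_add]; simp
    · rw [← map_mul, mul_div_cancel₀ _ ht, map_neg, map_one]
  rw [← coeff_eval₂_T_two, ← hψ, map_trace_pow, hB2, smul_pow, ← pow_mul, Matrix.trace_smul,
    ← map_trace_pow, smul_eq_mul, mul_pow, T_pow, ← map_pow, mul_comm (T _), ← single_eq_C_mul_T,
    AddMonoidAlgebra.coeff_single_mul_eq_mul_coeff 0 fun m _ => by omega]
  rw [hφ, AddMonoidAlgebra.coeff_mapRingHom]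
  simp [mul_comm]

/-! ### Termwise integration against `e⁻ᵗ` -/

theorem pow_mul_exp_neg_integral (k : ℕ) :
    MeasureTheory.IntegrableOn (fun t : ℝ => t ^ k * Real.exp (-t)) (Set.Ioi 0) ∧
      ∫ t in Set.Ioi (0 : ℝ), t ^ k * Real.exp (-t) = k.factorial := by
  have hk : (0 : ℝ) < k + 1 := by positivity
  have hfun : (fun t : ℝ => t ^ k * Real.exp (-t)) =
      fun t => Real.exp (-t) * t ^ ((k : ℝ) + 1 - 1) := by
    funext t
    rw [add_sub_cancel_right, Real.rpow_natCast, mul_comm]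
  rw [hfun, ← Real.Gamma_eq_integral hk, Real.Gamma_nat_eq_factorial]
  exact ⟨Real.GammaIntegral_convergent hk, rfl⟩

/-- The values of `F` matter for `0 < t` only; this leaves out `t = 0`, where `z = -1/t` makes no
sense. -/
theorem sum_mul_exp_neg_integral (n : ℕ) (a : ℕ → ℝ) (F : ℝ → ℝ)
    (hF : ∀ t, 0 < t → F t = ∑ j ∈ Finset.range (n + 1), a j * t ^ (n - j)) :
    MeasureTheory.IntegrableOn (fun t : ℝ => F t * Real.exp (-t)) (Set.Ioi 0) ∧
      ∫ t in Set.Ioi (0 : ℝ), F t * Real.exp (-t) =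
        ∑ j ∈ Finset.range (n + 1), a j * ((n - j).factorial : ℝ) := by
  have hEq : Set.EqOn (fun t : ℝ => F t * Real.exp (-t))
      (fun t => ∑ j ∈ Finset.range (n + 1), a j * (t ^ (n - j) * Real.exp (-t))) (Set.Ioi 0) := by
    intro t ht
    simp only [hF t ht, Finset.sum_mul, mul_assoc]
  have hint : ∀ j ∈ Finset.range (n + 1), MeasureTheory.Integrable
      (fun t : ℝ => a j * (t ^ (n - j) * Real.exp (-t)))
      (MeasureTheory.volume.restrict (Set.Ioi 0)) :=
    fun j _ => (pow_mul_exp_neg_integral (n - j)).1.const_mul (a j)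
  refine ⟨MeasureTheory.IntegrableOn.congr_fun (MeasureTheory.integrable_finsetSum _ hint)
    hEq.symm measurableSet_Ioi, ?_⟩
  rw [MeasureTheory.setIntegral_congr_fun measurableSet_Ioi hEq,
    MeasureTheory.integral_finsetSum _ hint]
  exact Finset.sum_congr rfl fun j _ => by
    rw [MeasureTheory.integral_const_mul, (pow_mul_exp_neg_integral (n - j)).2]

/-! ### Closed walks and the trace of `B` -/

/-- Entries of powers as sums over walks `a, w 0, …, w (k - 1), b`. -/
theorem pow_succ_apply_eq_sum_walks {ι R : Type*} [Fintype ι] [DecidableEq ι] [CommSemiring R]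
    (M : Matrix ι ι R) (k : ℕ) (a b : ι) :
    (M ^ (k + 1)) a b = ∑ w : Fin k → ι, ∏ i : Fin (k + 1),
      M ((Fin.cons a w : Fin (k + 1) → ι) i) ((Fin.snoc w b : Fin (k + 1) → ι) i) := by
  induction k generalizing a with
  | zero => simp [Fin.snoc]
  | succ k ih =>
    rw [pow_succ', Matrix.mul_apply]
    simp only [ih, Finset.mul_sum]
    rw [← Fintype.sum_prod_type', ← (Fin.consEquiv fun _ : Fin (k + 1) => ι).sum_comp]
    refine Finset.sum_congr rfl fun p _ => ?_
    rw [Fin.prod_univ_succ (n := k + 1)]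
    simp [Fin.consEquiv, ← Fin.cons_snoc_eq_snoc_cons]

theorem trace_pow_eq_sum_closed_walks {ι R : Type*} [Fintype ι] [DecidableEq ι] [CommSemiring R]
    (M : Matrix ι ι R) {k : ℕ} (hk : 0 < k) :
    (M ^ k).trace = ∑ w : Fin k → ι, ∏ i, M (w i) (w (finRotate k i)) := by
  obtain ⟨k, rfl⟩ := Nat.exists_eq_succ_of_ne_zero hk.ne'
  simp only [Matrix.trace, Matrix.diag, pow_succ_apply_eq_sum_walks, Nat.succ_eq_add_one]
  rw [← Fintype.sum_prod_type', ← (Fin.consEquiv fun _ : Fin (k + 1) => ι).sum_comp]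
  refine Finset.sum_congr rfl fun p _ => Finset.prod_congr rfl fun i _ => ?_
  congr 1
  refine Fin.lastCases ?_ (fun j => ?_) i
  · simp [Fin.consEquiv]
  · simp [Fin.consEquiv]

/-- The first letter of each of the nodes `fm⋆, mf, ff, mm, fm, mf⋆`. -/
def nodeFst : Fin 6 → Bool := ![false, true, false, true, false, true]

/-- The second letter of each of the nodes `fm⋆, mf, ff, mm, fm, mf⋆`. -/
def nodeSnd : Fin 6 → Bool := ![true, false, false, true, true, false]

/-- Whether a node is starred. -/
def nodeStar : Fin 6 → Bool := ![true, false, false, false, false, true]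

/-- The node with given letters and star; the star is ignored if the letters agree. -/
def node : Bool → Bool → Bool → Fin 6
  | false, true, true => 0
  | true, false, false => 1
  | false, false, _ => 2
  | true, true, _ => 3
  | false, true, false => 4
  | true, false, true => 5

theorem nodeFst_node (a b s : Bool) : nodeFst (node a b s) = a := by
  revert a b s; decide

theorem nodeSnd_node (a b s : Bool) : nodeSnd (node a b s) = b := by
  revert a b s; decide

theorem nodeStar_node (a b s : Bool) : nodeStar (node a b s) = (s && (a != b)) := by
  revert a b s; decide

theorem node_eq (u : Fin 6) : node (nodeFst u) (nodeSnd u) (nodeStar u) = u := by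
  revert u; decide

theorem nodeFst_ne_nodeSnd : ∀ u : Fin 6, nodeStar u = true → nodeFst u ≠ nodeSnd u := by
  decide

/-- The arcs of the graph: consecutive nodes overlap in a letter, three equal letters in a row are
excluded, and so are two consecutive stars. -/
def IsArc (u v : Fin 6) : Prop :=
  nodeSnd u = nodeFst v ∧ ¬ (nodeFst u = nodeSnd u ∧ nodeSnd u = nodeSnd v) ∧
    ¬ (nodeStar u = true ∧ nodeStar v = true)

instance (u v : Fin 6) : Decidable (IsArc u v) := by
  unfold IsArc; infer_instance

/-- The sign `+1` for male and `-1` for female: the exponent of `y`. -/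
def sexSign (b : Bool) : ℤ := if b then 1 else -1

open LaurentPolynomial in
theorem matB_apply (u v : Fin 6) :
    matB u v = if IsArc u v then
      AddMonoidAlgebra.single (sexSign (nodeSnd v))
        ((Polynomial.X : Polynomial ℤ) ^ (nodeStar v).toNat) else 0 := by
  rw [single_eq_C_mul_T]
  fin_cases u <;> fin_cases v <;>
    simp [matB, IsArc, nodeFst, nodeSnd, nodeStar, sexSign]

theorem prod_single {ι M R : Type*} [AddCommMonoid M] [CommSemiring R] (s : Finset ι)
    (a : ι → M) (r : ι → R) :
    ∏ i ∈ s, AddMonoidAlgebra.single (a i) (r i) =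
      AddMonoidAlgebra.single (∑ i ∈ s, a i) (∏ i ∈ s, r i) := by
  classical
  induction s using Finset.induction_on with
  | empty => rfl
  | insert i s hi ih =>
    rw [Finset.prod_insert hi, Finset.sum_insert hi, Finset.prod_insert hi, ih,
      AddMonoidAlgebra.single_mul_single]

open Classical in
theorem coeff_trace_matB_eq_card_walks {k : ℕ} (hk : 0 < k) (j : ℕ) :
    ((Matrix.trace (matB ^ k)).coeff 0).coeff j =
      ((Finset.univ.filter fun w : Fin k → Fin 6 =>
        (∀ i, IsArc (w i) (w (finRotate k i))) ∧ ∑ i, sexSign (nodeSnd (w i)) = 0 ∧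
          (Finset.univ.filter fun i => nodeStar (w i) = true).card = j).card : ℤ) := by
  rw [trace_pow_eq_sum_closed_walks _ hk, AddMonoidAlgebra.coeff_sum, Finsupp.finsetSum_apply,
    Polynomial.finsetSum_coeff, Finset.card_filter, Nat.cast_sum]
  refine Finset.sum_congr rfl fun w _ => ?_
  simp only [matB_apply]
  by_cases h : ∀ i, IsArc (w i) (w (finRotate k i))
  · have hs : (∑ i, (nodeStar (w i)).toNat) =
        (Finset.univ.filter fun i => nodeStar (w i) = true).card := by
      rw [Finset.card_filter]
      exact Finset.sum_congr rfl fun i _ => by cases nodeStar (w i) <;> rfl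
    rw [Finset.prod_congr rfl fun i _ => if_pos (h i), prod_single, Finset.prod_pow_eq_pow_sum,
      Equiv.sum_comp (finRotate k) fun i => sexSign (nodeSnd (w i)),
      Equiv.sum_comp (finRotate k) fun i => (nodeStar (w i)).toNat, hs,
      AddMonoidAlgebra.coeff_single, Finsupp.single_apply]
    by_cases h0 : ∑ i, sexSign (nodeSnd (w i)) = 0
    · rw [if_pos h0, Polynomial.coeff_X_pow, Nat.cast_ite, Nat.cast_one, Nat.cast_zero]
      exact if_congr ⟨fun e => ⟨h, h0, e.symm⟩, fun e => e.2.2.symm⟩ rfl rfl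
    · simp [h0]
  · obtain ⟨i, hi⟩ := not_forall.1 h
    rw [Finset.prod_eq_zero (Finset.mem_univ i) (if_neg hi)]
    simp [h, -finRotate_apply]

/-- A pattern of sexes `g` on the seats `Fin N` of a circular table, together with a set `A` of
marked seats: seat `i ∈ A` stands for a couple on the seats `i` and `i + 1`. There are as many men
as women, no three consecutive people of the same sex, and the marked couples are mixed and
disjoint. -/
def IsMarkedPattern {N : ℕ} (g : Fin N → Bool) (A : Finset (Fin N)) : Prop :=
  (∀ i, ¬ (g i = g (finRotate N i) ∧ g (finRotate N i) = g (finRotate N (finRotate N i)))) ∧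
    (∀ i ∈ A, g i ≠ g (finRotate N i)) ∧ (∀ i ∈ A, finRotate N i ∉ A) ∧ ∑ i, sexSign (g i) = 0

open Classical in
/-- A closed walk is the same as a marked pattern: node `i` of the walk records the sexes at the
seats `i`, `i + 1` and whether these two seats are marked. -/
theorem coeff_trace_matB_eq_card_patterns {k : ℕ} (hk : 0 < k) (j : ℕ) :
    ((Matrix.trace (matB ^ k)).coeff 0).coeff j =
      ((Finset.univ.filter fun p : (Fin k → Bool) × Finset (Fin k) =>
        IsMarkedPattern p.1 p.2 ∧ p.2.card = j).card : ℤ) := by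
  rw [coeff_trace_matB_eq_card_walks hk]
  congr 1
  refine Finset.card_nbij'
    (fun w => (fun i => nodeFst (w i), Finset.univ.filter fun i => nodeStar (w i) = true))
    (fun p i => node (p.1 i) (p.1 (finRotate k i)) (decide (i ∈ p.2))) ?_ ?_ ?_ ?_
  · intro w hw
    obtain ⟨h1, h2, h3⟩ := (Finset.mem_filter.1 hw).2
    refine Finset.mem_coe.2 (Finset.mem_filter.2 ⟨Finset.mem_univ _, ⟨?_, ?_, ?_, ?_⟩, h3⟩)
    · intro i
      dsimp only
      rw [← (h1 i).1, ← (h1 (finRotate k i)).1]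
      exact (h1 i).2.1
    · intro i hi
      dsimp only
      rw [← (h1 i).1]
      exact nodeFst_ne_nodeSnd _ (Finset.mem_filter.1 hi).2
    · intro i hi hi'
      exact (h1 i).2.2 ⟨(Finset.mem_filter.1 hi).2, (Finset.mem_filter.1 hi').2⟩
    · dsimp only
      rw [← Equiv.sum_comp (finRotate k) fun i => sexSign (nodeFst (w i)), ← h2]
      exact Finset.sum_congr rfl fun i _ => by rw [(h1 i).1]
  · rintro ⟨g, A⟩ hp
    obtain ⟨⟨h1, h2, h3, h4⟩, h5⟩ := (Finset.mem_filter.1 hp).2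
    dsimp only at h1 h2 h3 h4 h5
    have hstar : ∀ i, nodeStar (node (g i) (g (finRotate k i)) (decide (i ∈ A))) = true ↔
        i ∈ A := by
      intro i
      rw [nodeStar_node]
      simpa using h2 i
    refine Finset.mem_coe.2 (Finset.mem_filter.2 ⟨Finset.mem_univ _, ?_, ?_, ?_⟩)
    · intro i
      refine ⟨?_, ?_, ?_⟩
      · rw [nodeSnd_node, nodeFst_node]
      · rw [nodeFst_node, nodeSnd_node, nodeSnd_node]
        exact h1 i
      · rw [hstar, hstar]
        exact fun h => h3 i h.1 h.2
    · simp only [nodeSnd_node]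
      rw [Equiv.sum_comp (finRotate k) fun i => sexSign (g i), h4]
    · simp only [hstar]
      simpa using h5
  · intro w hw
    obtain ⟨h1, -, -⟩ := (Finset.mem_filter.1 hw).2
    funext i
    simp [← (h1 i).1, node_eq, -finRotate_apply]
  · rintro ⟨g, A⟩ hp
    obtain ⟨⟨h1, h2, h3, h4⟩, h5⟩ := (Finset.mem_filter.1 hp).2
    refine Prod.ext (funext fun i => nodeFst_node _ _ _) (Finset.ext fun i => ?_)
    simpa [nodeStar_node] using h2 i

/-! ### Seatings with prescribed sexes and adjacent couples -/

theorem finRotate_ne_self {n : ℕ} (hn : 1 < n) (i : Fin (2 * n)) : finRotate (2 * n) i ≠ i := by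
  obtain ⟨m, hm⟩ : ∃ m, 2 * n = m + 3 := ⟨2 * n - 3, by omega⟩
  generalize 2 * n = N at *
  subst hm
  rw [finRotate_apply]
  simp

theorem finRotate_finRotate_ne_self {n : ℕ} (hn : 1 < n) (i : Fin (2 * n)) :
    finRotate (2 * n) (finRotate (2 * n) i) ≠ i := by
  obtain ⟨m, hm⟩ : ∃ m, 2 * n = m + 3 := ⟨2 * n - 3, by omega⟩
  generalize 2 * n = N at *
  subst hm
  rw [finRotate_apply, finRotate_apply, add_assoc, Ne, add_eq_left, Fin.ext_iff]
  simp [Fin.val_add, Nat.mod_eq_of_lt]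

theorem person_ext {n : ℕ} {p q : Person n} (h1 : p.1 = q.1) (h2 : p.2 = q.2) : p = q :=
  Prod.ext h1 h2

/-- The seatings with given sexes on the seats such that the seats `i`, `i + 1` are taken by a
couple for each `i ∈ A`. -/
abbrev PatternSeating {n : ℕ} (g : Fin (2 * n) → Bool) (A : Finset (Fin (2 * n))) : Type :=
  {s : Seating n // (∀ i, (s i).2 = g i) ∧ ∀ i ∈ A, (s i).1 = (s (finRotate (2 * n) i)).1}

/-- Marking adjacent couples of an admissible seating gives a marked pattern. The hypothesis `1 < n`
ensures that the seats `i`, `i + 1` and `i + 2` are distinct. -/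
theorem isMarkedPattern_of_seating {n : ℕ} (hn : 1 < n) (s : Seating n) (hs : NoThreeSameSex s)
    (A : Finset (Fin (2 * n))) (hA : ∀ i ∈ A, (s i).1 = (s (finRotate (2 * n) i)).1) :
    IsMarkedPattern (fun i => (s i).2) A := by
  have h2 : ∀ i ∈ A, (s i).2 ≠ (s (finRotate (2 * n) i)).2 := fun i hi h =>
    finRotate_ne_self hn i (s.injective (person_ext (hA i hi) h)).symm
  refine ⟨hs, h2, fun i hi hi' => ?_, ?_⟩
  · -- Three consecutive seats would be taken by the two members of one couple.
    refine finRotate_finRotate_ne_self hn i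
      (s.injective (person_ext ((hA i hi).trans (hA _ hi')) ?_)).symm
    rw [Bool.eq_not.2 (h2 i hi), Bool.eq_not.2 (h2 _ hi'), Bool.not_not]
  · rw [s.sum_comp fun p => sexSign p.2, Fintype.sum_prod_type]
    simp [sexSign]

theorem card_filter_sex {n : ℕ} {g : Fin (2 * n) → Bool} (h : ∑ i, sexSign (g i) = 0) :
    (Finset.univ.filter fun i => g i = true).card = n ∧
      (Finset.univ.filter fun i => g i = false).card = n := by
  have h1 : ∑ i, sexSign (g i) = ((Finset.univ.filter fun i => g i = true).card : ℤ) -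
      (Finset.univ.filter fun i => g i = false).card := by
    rw [Finset.card_filter, Finset.card_filter, Nat.cast_sum, Nat.cast_sum,
      ← Finset.sum_sub_distrib]
    exact Finset.sum_congr rfl fun i _ => by cases g i <;> rfl
  have h2 := Finset.card_filter_add_card_filter_not (s := (Finset.univ : Finset (Fin (2 * n))))
    (fun i => g i = true)
  simp only [Bool.not_eq_true, Finset.card_univ, Fintype.card_fin] at h2
  omega

/-- Seat the women arbitrarily, put the husbands of the women in marked couples next to them, and
the other husbands arbitrarily on the seats left for men. -/
theorem nonempty_patternSeating {n : ℕ} {g : Fin (2 * n) → Bool} {A : Finset (Fin (2 * n))}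
    (h : IsMarkedPattern g A) : Nonempty (PatternSeating g A) := by
  classical
  obtain ⟨-, h2, h3, h4⟩ := h
  obtain ⟨hM, hF⟩ := card_filter_sex h4
  set ρ := finRotate (2 * n) with hρ
  set F := Finset.univ.filter fun i => g i = false with hFdef
  -- The seat of the wife, for a man on a marked seat or directly after one.
  set p : {i // g i = true} → Fin (2 * n) := fun i => if i.1 ∈ A then ρ i else ρ.symm i with hp
  set S : Finset {i // g i = true} := Finset.univ.filter fun i => i.1 ∈ A ∨ ρ.symm i ∈ A with hS
  have hcard : Fintype.card {i // g i = true} = F.card := by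
    rw [Fintype.card_subtype, hM, hF]
  have hmaps : Finset.image p S ⊆ F := by
    intro k hk
    obtain ⟨⟨i, hi⟩, hiS, rfl⟩ := Finset.mem_image.1 hk
    rw [hFdef, Finset.mem_filter]
    refine ⟨Finset.mem_univ _, ?_⟩
    by_cases hiA : i ∈ A
    · simp only [hp, if_pos hiA]
      have := h2 i hiA
      rw [hi] at this
      exact Bool.eq_false_iff.2 this.symm
    · simp only [hp, if_neg hiA]
      have := h2 _ ((Finset.mem_filter.1 hiS).2.resolve_left hiA)
      rw [ρ.apply_symm_apply, hi] at this
      exact Bool.eq_false_iff.2 this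
  have hinj : Set.InjOn p S := by
    rintro ⟨i, hi⟩ hiS ⟨j, hj⟩ hjS hij
    have hiS := (Finset.mem_filter.1 hiS).2
    have hjS := (Finset.mem_filter.1 hjS).2
    simp only [hp] at hij hiS hjS
    refine Subtype.ext ?_
    split_ifs at hij with hiA hjA hjA
    · exact ρ.injective hij
    · exact absurd (hij ▸ hjS.resolve_left hjA) (h3 i hiA)
    · exact absurd (hij ▸ hiS.resolve_left hiA) (h3 j hjA)
    · exact ρ.symm.injective hij
  obtain ⟨π, hπ⟩ := Finset.exists_equiv_extend_of_card_eq hcard hmaps hinj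
  let e : F ≃ Fin n := Finset.equivFinOfCardEq hF
  have hmem : ∀ {i}, ¬ g i = true → i ∈ F := fun {i} hi =>
    Finset.mem_filter.2 ⟨Finset.mem_univ _, Bool.eq_false_iff.2 hi⟩
  let f : Fin (2 * n) → Person n := fun i =>
    (if hi : g i = true then e (π ⟨i, hi⟩) else e ⟨i, hmem hi⟩, g i)
  have hf : Function.Bijective f := by
    refine (Fintype.bijective_iff_injective_and_card f).2 ⟨fun i j hij => ?_, by simp [mul_comm]⟩
    have hg : g i = g j := congrArg Prod.snd hij
    have he : (f i).1 = (f j).1 := congrArg Prod.fst hij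
    by_cases hi : g i = true
    · have hj : g j = true := hg ▸ hi
      simp only [f, dif_pos hi, dif_pos hj] at he
      exact congrArg Subtype.val (π.injective (e.injective he))
    · have hj : ¬ g j = true := hg ▸ hi
      simp only [f, dif_neg hi, dif_neg hj] at he
      exact congrArg Subtype.val (e.injective he)
  refine ⟨⟨Equiv.ofBijective f hf, fun i => rfl, fun i hi => ?_⟩⟩
  change (f i).1 = (f (ρ i)).1
  by_cases hgi : g i = true
  · have hgr : ¬ g (ρ i) = true := fun h => h2 i hi (hgi.trans h.symm)
    simp only [f, dif_pos hgi, dif_neg hgr]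
    congr 1
    refine Subtype.ext ((hπ _ (Finset.mem_filter.2 ⟨Finset.mem_univ _, Or.inl hi⟩)).trans ?_)
    simp only [hp, if_pos hi]
  · have hgr : g (ρ i) = true := by
      have := h2 i hi
      revert this hgi
      cases g i <;> cases g (ρ i) <;> simp
    simp only [f, dif_neg hgi, dif_pos hgr]
    congr 1
    refine Subtype.ext (Eq.symm ((hπ _ (Finset.mem_filter.2 ⟨Finset.mem_univ _, Or.inr ?_⟩)).trans
      ?_))
    · simpa using hi
    · simp only [hp, if_neg (h3 i hi)]
      exact ρ.symm_apply_apply i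

/-- Pairs of permutations that agree on a set `K`: the first one is arbitrary, and the quotient of
the two fixes `K` pointwise. -/
theorem card_pairs_perm {n : ℕ} (K : Finset (Fin n)) :
    Nat.card {e : Bool → Equiv.Perm (Fin n) // ∀ c ∈ K, e false c = e true c} =
      n.factorial * (n - K.card).factorial := by
  classical
  let E : {e : Bool → Equiv.Perm (Fin n) // ∀ c ∈ K, e false c = e true c} ≃
      Equiv.Perm (Fin n) × {τ : Equiv.Perm (Fin n) // ∀ c, ¬ c ∉ K → τ c = c} :=
    { toFun := fun e => (e.1 false, ⟨(e.1 false)⁻¹ * e.1 true, fun c hc => by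
        rw [Equiv.Perm.mul_apply, ← e.2 c (not_not.1 hc)]
        exact (e.1 false).symm_apply_apply c⟩)
      invFun := fun q => ⟨fun b => if b then q.1 * q.2.1 else q.1, fun c hc => by
        simp [q.2.2 c (not_not.2 hc)]⟩
      left_inv := fun e => Subtype.ext (funext fun b => by cases b <;> simp)
      right_inv := fun q => by ext <;> simp }
  rw [Nat.card_congr E, Nat.card_prod, Nat.card_perm,
    ← Nat.card_congr (Equiv.Perm.subtypeEquivSubtypePerm fun c => c ∉ K), Nat.card_perm]
  simp

/-- Relative to one seating `s₀` of the pattern, any other permutes the women by one permutation of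
`Fin n` and the men by another; these have to agree on the marked couples. -/
theorem card_patternSeating {n : ℕ} {g : Fin (2 * n) → Bool} {A : Finset (Fin (2 * n))}
    (h : IsMarkedPattern g A) :
    A.card ≤ n ∧ Nat.card (PatternSeating g A) = n.factorial * (n - A.card).factorial := by
  classical
  obtain ⟨⟨s₀, hs₀, hA₀⟩⟩ := nonempty_patternSeating h
  obtain ⟨-, h2, h3, -⟩ := h
  set K : Finset (Fin n) := A.image fun i => (s₀ i).1 with hK
  have hcard : K.card = A.card := by
    refine Finset.card_image_of_injOn fun i hi j hj hij => ?_
    by_contra hne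
    -- Seats `i ≠ j` taken by one couple have different sexes, so that `i + 1`, taken by the same
    -- couple, is `j`; but marked couples are disjoint.
    have hg : g i ≠ g j := fun hg =>
      hne (s₀.injective (person_ext hij (by rw [hs₀, hs₀, hg])))
    have hg' : g (finRotate (2 * n) i) = g j :=
      (Bool.eq_not.2 (h2 i hi).symm).trans (Bool.eq_not.2 hg.symm).symm
    have : finRotate (2 * n) i = j :=
      s₀.injective (person_ext ((hA₀ i hi).symm.trans hij) (by rw [hs₀, hs₀, hg']))
    exact h3 i hi (this ▸ hj)
  refine ⟨hcard ▸ (Finset.card_le_univ K).trans_eq (Fintype.card_fin n), ?_⟩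
  rw [← hcard, ← card_pairs_perm K]
  symm
  -- The condition on `A` says that the two permutations agree on the marked couples.
  have hcond : ∀ (e : Bool → Equiv.Perm (Fin n)), (∀ c ∈ K, e false c = e true c) ↔
      ∀ i ∈ A, e (s₀ i).2 (s₀ i).1 =
        e (s₀ (finRotate (2 * n) i)).2 (s₀ (finRotate (2 * n) i)).1 := by
    intro e
    rw [hK, Finset.forall_mem_image]
    refine forall₂_congr fun i hi => ?_
    have := h2 i hi
    rw [← hA₀ i hi, hs₀, hs₀]
    revert this
    cases g i <;> cases g (finRotate (2 * n) i) <;> simp [eq_comm]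
  refine Nat.card_congr (Equiv.ofBijective
    (fun e => ⟨s₀.trans (Equiv.prodCongrLeft e.1), fun i => hs₀ i, (hcond e.1).1 e.2⟩) ⟨?_, ?_⟩)
  · rintro ⟨e, he⟩ ⟨e', he'⟩ hee
    refine Subtype.ext (funext fun b => Equiv.ext fun c => ?_)
    have := DFunLike.congr_fun (congrArg Subtype.val hee) (s₀.symm (c, b))
    simpa using this
  · rintro ⟨s, hs, hA⟩
    have hsex : ∀ p, (s (s₀.symm p)).2 = p.2 := fun p => by
      rw [hs, ← hs₀, s₀.apply_symm_apply]
    let e : Bool → Equiv.Perm (Fin n) := fun b =>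
      Equiv.ofBijective (fun c => (s (s₀.symm (c, b))).1) (Finite.injective_iff_bijective.1 <| by
        intro c c' hc
        have := s.injective (person_ext hc ((hsex (c, b)).trans (hsex (c', b)).symm))
        exact congrArg Prod.fst (s₀.symm.injective this))
    have he : ∀ i, e (s₀ i).2 (s₀ i).1 = (s i).1 := fun i => by simp [e]
    refine ⟨⟨e, (hcond e).2 fun i hi => by rw [he, he, hA i hi]⟩,
      Subtype.ext (Equiv.ext fun i => ?_)⟩
    exact person_ext (he i) ((hs₀ i).trans (hs i).symm)

/-! ### Inclusion–exclusion over the adjacent couples -/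

open Classical in
/-- Each seating without three consecutive people of the same sex is weighted by
`∑ (-1)^|A|` over all sets `A` of couples sitting together, which vanishes unless there are none;
the sum over the seatings and `A` is then grouped by the pattern. -/
theorem count_eq_sum_patterns {n : ℕ} (hn : 1 < n) :
    (count n : ℤ) = ∑ p : (Fin (2 * n) → Bool) × Finset (Fin (2 * n)),
      if IsMarkedPattern p.1 p.2 then
        (-1 : ℤ) ^ p.2.card * (n.factorial * (n - p.2.card).factorial : ℕ) else 0 := by
  let close : Seating n → Finset (Fin (2 * n)) := fun s =>
    Finset.univ.filter fun i => (s i).1 = (s (finRotate (2 * n) i)).1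
  have hclose : ∀ s A, A ⊆ close s ↔ ∀ i ∈ A, (s i).1 = (s (finRotate (2 * n) i)).1 := by
    intro s A
    simp only [close, Finset.subset_iff, Finset.mem_filter, Finset.mem_univ, true_and]
  have hempty : ∀ s, close s = ∅ ↔ NoCloseCouple s := by
    intro s
    simp only [close, Finset.filter_eq_empty_iff, Finset.mem_univ, true_imp_iff, NoCloseCouple, Ne]
  have hseating : ∀ s : Seating n,
      (if NoCloseCouple s ∧ NoThreeSameSex s then (1 : ℤ) else 0) =
        ∑ p : (Fin (2 * n) → Bool) × Finset (Fin (2 * n)),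
          if IsMarkedPattern p.1 p.2 ∧ (∀ i, (s i).2 = p.1 i) ∧
            ∀ i ∈ p.2, (s i).1 = (s (finRotate (2 * n) i)).1 then (-1 : ℤ) ^ p.2.card else 0 := by
    intro s
    rw [Fintype.sum_prod_type, Fintype.sum_eq_single fun i => (s i).2]
    · by_cases h3 : NoThreeSameSex s
      · simp only [h3, and_true, ← hempty, ← Finset.sum_powerset_neg_one_pow_card]
        rw [← Finset.sum_filter]
        refine Finset.sum_congr (Finset.ext fun A => ?_) fun _ _ => rfl
        rw [Finset.mem_powerset, Finset.mem_filter, hclose]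
        exact ⟨fun h => ⟨Finset.mem_univ _, isMarkedPattern_of_seating hn s h3 A h,
          fun _ => trivial, h⟩, fun h => h.2.2.2⟩
      · rw [if_neg fun h => h3 h.2]
        exact (Finset.sum_eq_zero fun A _ => if_neg fun h => h3 h.1.1).symm
    · intro g hg
      exact Finset.sum_eq_zero fun A _ => if_neg fun h => hg (funext fun i => (h.2.1 i).symm)
  rw [count, Nat.card_eq_fintype_card, Fintype.card_subtype, Finset.card_filter, Nat.cast_sum]
  simp only [Nat.cast_ite, Nat.cast_one, Nat.cast_zero, hseating]
  rw [Finset.sum_comm]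
  refine Finset.sum_congr rfl fun p _ => ?_
  by_cases hp : IsMarkedPattern p.1 p.2
  · rw [if_pos hp, ← (card_patternSeating hp).2, Nat.card_eq_fintype_card, Fintype.card_subtype,
      Finset.card_filter, Nat.cast_sum, Finset.mul_sum]
    refine Finset.sum_congr rfl fun s _ => ?_
    simp only [hp, true_and, Nat.cast_ite, Nat.cast_one, Nat.cast_zero, mul_ite, mul_one, mul_zero]
  · rw [if_neg hp]
    exact Finset.sum_eq_zero fun s _ => if_neg fun h => hp h.1

theorem count_eq_sum_coeff {n : ℕ} (hn : 1 < n) :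
    (count n : ℤ) =
      (n.factorial : ℤ) * ∑ j ∈ Finset.range (n + 1),
        (-1 : ℤ) ^ j * ((n - j).factorial : ℤ) *
          ((Matrix.trace (matB ^ (2 * n))).coeff 0).coeff j := by
  classical
  rw [count_eq_sum_patterns hn, ← Finset.sum_filter, Finset.mul_sum,
    ← Finset.sum_fiberwise_of_maps_to (g := fun p => p.2.card) (t := Finset.range (n + 1))]
  · refine Finset.sum_congr rfl fun j _ => ?_
    rw [coeff_trace_matB_eq_card_patterns (by omega), Finset.filter_filter,
      Finset.sum_congr rfl fun p hp => by rw [(Finset.mem_filter.1 hp).2.2], Finset.sum_const,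
      nsmul_eq_mul]
    push_cast
    ring
  · intro p hp
    exact Finset.mem_range.2
      (Nat.lt_succ_of_le (card_patternSeating (Finset.mem_filter.1 hp).2).1)

/-- At most `n` disjoint couples can be marked among `2n` seats. -/
theorem natDegree_coeff_trace_matB_le {n : ℕ} (hn : 1 < n) :
    ((Matrix.trace (matB ^ (2 * n))).coeff 0).natDegree ≤ n := by
  classical
  refine Polynomial.natDegree_le_iff_coeff_eq_zero.2 fun j hj => ?_
  rw [coeff_trace_matB_eq_card_patterns (by omega), Nat.cast_eq_zero, Finset.card_eq_zero,
    Finset.filter_eq_empty_iff]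
  rintro p - ⟨hp, rfl⟩
  exact absurd (card_patternSeating hp).1 (by omega)

theorem coeff_trace_matB2_eq_sum {n : ℕ} (hn : 1 < n) {t : ℝ} (ht : 0 < t) :
    (Matrix.trace (matB2 t ^ n)).coeff n = ∑ j ∈ Finset.range (n + 1),
      ((-1) ^ j * (((Matrix.trace (matB ^ (2 * n))).coeff 0).coeff j : ℝ)) * t ^ (n - j) := by
  rw [coeff_trace_matB2 n ht.ne', Polynomial.eval₂_eq_sum_range'
    _ (Nat.lt_succ_of_le (natDegree_coeff_trace_matB_le hn)), Finset.mul_sum]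
  refine Finset.sum_congr rfl fun j hj => ?_
  have hj' : n = (n - j) + j :=
    (Nat.sub_add_cancel (Nat.lt_succ_iff.1 (Finset.mem_range.1 hj))).symm
  rw [show t ^ n = t ^ (n - j) * t ^ j by rw [← pow_add, ← hj'], div_pow, eq_intCast]
  field_simp

end TernaryMenage

theorem mainTheorem2 (n : ℕ) (hn : 1 < n) :
    ((TernaryMenage.count n : ℤ) =
      (n.factorial : ℤ) * ∑ j ∈ Finset.range (n + 1),
        (-1 : ℤ) ^ j * ((n - j).factorial : ℤ) *
          ((Matrix.trace (TernaryMenage.matB ^ (2 * n))).coeff 0).coeff j) ∧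
    (MeasureTheory.IntegrableOn
        (fun t : ℝ => (Matrix.trace (TernaryMenage.matB2 t ^ n)).coeff n * Real.exp (-t))
        (Set.Ioi 0) ∧
      (TernaryMenage.count n : ℝ) =
        (n.factorial : ℝ) * ∫ t in Set.Ioi (0 : ℝ),
          (Matrix.trace (TernaryMenage.matB2 t ^ n)).coeff n * Real.exp (-t)) ∧
    (MeasureTheory.IntegrableOn
        (fun t : ℝ => MvPowerSeries.coeff (Finsupp.single 0 n + Finsupp.single 1 n)
          (TernaryMenage.ratSeries t) * Real.exp (-t))
        (Set.Ioi 0) ∧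
      (TernaryMenage.count n : ℝ) =
        (n.factorial : ℝ) * ∫ t in Set.Ioi (0 : ℝ),
          MvPowerSeries.coeff (Finsupp.single 0 n + Finsupp.single 1 n)
            (TernaryMenage.ratSeries t) * Real.exp (-t)) := by
  simp only [TernaryMenage.coeff_ratSeries]
  obtain ⟨hint, hval⟩ := TernaryMenage.sum_mul_exp_neg_integral n _ _
    fun _ ht => TernaryMenage.coeff_trace_matB2_eq_sum hn ht
  have hcount : (TernaryMenage.count n : ℝ) =
      (n.factorial : ℝ) * ∫ t in Set.Ioi (0 : ℝ),
        (Matrix.trace (TernaryMenage.matB2 t ^ n)).coeff n * Real.exp (-t) := by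
    rw [hval, ← Int.cast_natCast, TernaryMenage.count_eq_sum_coeff hn]
    push_cast
    congr 1
    exact Finset.sum_congr rfl fun j _ => by ring
  exact ⟨TernaryMenage.count_eq_sum_coeff hn, ⟨hint, hcount⟩, hint, hcount⟩
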